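/- Let $\mathbb K$ be a field. An extended diassociative semigroup (EDS) is a set $\Omega$ with four operations $\leftarrow,\rightarrow,\triangleleft,\triangleright:\Omega\times\Omega\to\Omega$ such that for all $\alpha,\beta,\gamma\in\Omega$: $(\alpha\leftarrow\beta)\leftarrow\gamma=\alpha\leftarrow(\beta\leftarrow\gamma)=\alpha\leftarrow(\beta\rightarrow\gamma)$; $(\alpha\rightarrow\beta)\leftarrow\gamma=\alpha\rightarrow(\beta\leftarrow\gamma)$; $(\alpha\rightarrow\beta)\rightarrow\gamma=(\alpha\leftarrow\beta)\rightarrow\gamma=\alpha\rightarrow(\beta\rightarrow\gamma)$; $\alpha\triangleright(\beta\leftarrow\gamma)=\alpha\triangleright\beta$; $(\alpha\rightarrow\beta)\triangleleft\gamma=\beta\triangleleft\gamma$; with $\delta=\alpha\triangleleft\beta$ and $\varepsilon=(\alpha\leftarrow\beta)\triangleleft\gamma$: $\delta\leftarrow\varepsilon=\alpha\triangleleft(\beta\leftarrow\gamma)$, $\delta\triangleleft\varepsilon=\beta\triangleleft\gamma$, $\delta\rightarrow\varepsilon=\alpha\triangleleft(\beta\rightarrow\gamma)$, $\delta\triangleright\varepsilon=\beta\triangleright\gamma$;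 with $\delta'=\alpha\triangleright(\beta\rightarrow\gamma)$ and $\varepsilon'=\beta\triangleright\gamma$: $\delta'\leftarrow\varepsilon'=(\alpha\leftarrow\beta)\triangleright\gamma$, $\delta'\triangleleft\varepsilon'=\alpha\triangleleft\beta$, $\delta'\rightarrow\varepsilon'=(\alpha\rightarrow\beta)\triangleright\gamma$, $\delta'\triangleright\varepsilon'=\alpha\triangleright\beta$. The EDS $\Omega$ is nondegenerate if the maps $\Omega^2\to\Omega^2$ given by $(\alpha,\beta)\mapsto(\alpha\leftarrow\beta,\alpha\triangleleft\beta)$ and $(\alpha,\beta)\mapsto(\alpha\rightarrow\beta,\alpha\triangleright\beta)$ are bijective, and commutative if $\alpha\rightarrow\beta=\beta\leftarrow\alpha$ and $\alpha\triangleright\beta=\beta\triangleleft\alpha$ for all $\alpha,\beta$. For a $\mathbb K$-vector space $V$ let $\mathrm{Sh}^+_\Omega(V)=\bigoplus_{n\ge1}(\mathbb K\Omega)^{\otimes(n-1)}\otimes V^{\otimes n}$, spanned by the typed words $\alpha_2\ldots\alpha_n\otimes v_1\ldots v_n$, and let $(\alpha\otimes v)\cdot(\alpha_2\ldots\alpha_n\otimes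 v_1\ldots v_n)=\alpha\alpha_2\ldots\alpha_n\otimes vv_1\ldots v_n$. Bilinear products $\prec_\alpha,\succ_\alpha$ ($\alpha\in\Omega$) on $\mathrm{Sh}^+_\Omega(V)$ are defined inductively by, for $v\in V$, $\gamma\in\Omega$ and typed words $x,y$, $$v\prec_\alpha y=(\alpha\otimes v)\cdot y,\qquad x\succ_\alpha v=(\alpha\otimes v)\cdot x,$$ $$((\gamma\otimes v)\cdot x)\prec_\alpha y=((\gamma\leftarrow\alpha)\otimes v)\cdot(x\prec_{\gamma\triangleleft\alpha}y)+((\gamma\rightarrow\alpha)\otimes v)\cdot(x\succ_{\gamma\triangleright\alpha}y),$$ $$x\succ_\alpha((\gamma\otimes v)\cdot y)=((\alpha\leftarrow\gamma)\otimes v)\cdot(x\prec_{\alpha\triangleleft\gamma}y)+((\alpha\rightarrow\gamma)\otimes v)\cdot(x\succ_{\alpha\triangleright\gamma}y).$$ The space $\mathbb K\Omega\otimes\mathrm{Sh}^+_\Omega(V)$ is given the bilinear products $$\alpha\otimes x\prec\beta\otimes y=(\alpha\leftarrow\beta)\otimes(x\prec_{\alpha\triangleleft\beta}y),\qquad \alpha\otimes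 x\succ\beta\otimes y=(\alpha\rightarrow\beta)\otimes(x\succ_{\alpha\triangleright\beta}y).$$ A dendriform bialgebra is a vector space $A$ with bilinear products $\prec,\succ$ satisfying, with $\cdot=\prec+\succ$, $(x\prec y)\prec z=x\prec(y\cdot z)$, $(x\succ y)\prec z=x\succ(y\prec z)$, $(x\cdot y)\succ z=x\succ(y\succ z)$, and with a coassociative (not necessarily counitary) coproduct $\Delta:A\to A\otimes A$, written $\Delta(a)=a'\otimes a''$, such that for all $x,y\in A$: $$\Delta(x\prec y)=x\otimes y+x'\prec y\otimes x''+x'\otimes x''\cdot y+x\prec y'\otimes y''+x'\prec y'\otimes x''\cdot y'',$$ $$\Delta(x\succ y)=y\otimes x+x'\succ y\otimes x''+y'\otimes x\cdot y''+x\succ y'\otimes y''+x'\succ y'\otimes x''\cdot y''.$$ **Proposition.** Let $\Omega$ be a nondegenerate EDS and let $V$ be a nonzero $\mathbb K$-vector space. The following conditions are equivalent: 1. There exists a unique coproduct $\Delta$ on $\mathbb K\Omega\otimes\mathrm{Sh}^+_\Omega(V)$ making it (with the products $\prec,\succ$ above) a dendriform bialgebra and such that $\Delta(\alpha\otimes v)=0$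 for all $v\in V$ and $\alpha\in\Omega$. 2. $\Omega$ is commutative. -/

import Mathlib

open scoped TensorProduct DirectSum

/-- An extended diassociative semigroup (EDS): a set with four operations
`left = ←`, `right = →`, `tleft = ◁`, `tright = ▷`. -/
structure EDS (Ω : Type*) where
  /-- the operation `α ← β` -/
  left : Ω → Ω → Ω
  /-- the operation `α → β` -/
  right : Ω → Ω → Ω
  /-- the operation `α ◁ β` -/
  tleft : Ω → Ω → Ω
  /-- the operation `α ▷ β` -/
  tright : Ω → Ω → Ω
  -- `(Ω, ←, →)` is a diassociative semigroup
  left_left : ∀ a b c, left (left a b) c = left a (left b c)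
  left_left' : ∀ a b c, left a (left b c) = left a (right b c)
  right_left : ∀ a b c, left (right a b) c = right a (left b c)
  right_right : ∀ a b c, right (right a b) c = right (left a b) c
  right_right' : ∀ a b c, right (left a b) c = right a (right b c)
  -- compatibility of the four operations
  tright_left : ∀ a b c, tright a (left b c) = tright a b
  right_tleft : ∀ a b c, tleft (right a b) c = tleft b c
  tleft_left : ∀ a b c, left (tleft a b) (tleft (left a b) c) = tleft a (left b c)
  tleft_tleft : ∀ a b c, tleft (tleft a b) (tleft (left a b) c) = tleft b c
  tleft_right : ∀ a b c, right (tleft a b) (tleft (left a b) c) = tleft a (right b c)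
  tleft_tright : ∀ a b c, tright (tleft a b) (tleft (left a b) c) = tright b c
  tright_left_tright : ∀ a b c, left (tright a (right b c)) (tright b c) = tright (left a b) c
  tright_tleft_tright : ∀ a b c, tleft (tright a (right b c)) (tright b c) = tleft a b
  tright_right_tright : ∀ a b c, right (tright a (right b c)) (tright b c) = tright (right a b) c
  tright_tright_tright : ∀ a b c, tright (tright a (right b c)) (tright b c) = tright a b

/-- `φ_← (α, β) = (α ← β, α ◁ β)`. -/
def EDS.phiLeft {Ω : Type*} (E : EDS Ω) (p : Ω × Ω) : Ω × Ω :=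
  (E.left p.1 p.2, E.tleft p.1 p.2)

/-- `φ_→ (α, β) = (α → β, α ▷ β)`. -/
def EDS.phiRight {Ω : Type*} (E : EDS Ω) (p : Ω × Ω) : Ω × Ω :=
  (E.right p.1 p.2, E.tright p.1 p.2)

/-- An EDS is nondegenerate if `φ_←` and `φ_→` are bijective. -/
def EDS.Nondegenerate {Ω : Type*} (E : EDS Ω) : Prop :=
  Function.Bijective E.phiLeft ∧ Function.Bijective E.phiRight

/-- An EDS is commutative if it equals its opposite. -/
def EDS.Commutative {Ω : Type*} (E : EDS Ω) : Prop :=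
  ∀ a b, E.right a b = E.left b a ∧ E.tright a b = E.tleft b a

namespace TypedWord

noncomputable section

/-- `tcons m (m₁ ⊗ ⋯ ⊗ mₙ) = m ⊗ m₁ ⊗ ⋯ ⊗ mₙ`. -/
def tcons (K M : Type*) [Field K] [AddCommGroup M] [Module K M] (n : ℕ) :
    M →ₗ[K] (⨂[K]^n M) →ₗ[K] (⨂[K]^(n + 1) M) :=
  (PiTensorProduct.lift (R := K) (s := fun _ : Fin n => M)
    (E := ⨂[K]^(n + 1) M)).toLinearMap ∘ₗ
    (PiTensorProduct.tprod K (s := fun _ : Fin (n + 1) => M)).curryLeft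

/-- `tuncons (m₀ ⊗ m₁ ⊗ ⋯ ⊗ mₙ) = m₀ ⊗ (m₁ ⊗ ⋯ ⊗ mₙ)`. -/
def tuncons (K M : Type*) [Field K] [AddCommGroup M] [Module K M] (n : ℕ) :
    (⨂[K]^(n + 1) M) →ₗ[K] M ⊗[K] (⨂[K]^n M) :=
  PiTensorProduct.lift
    (LinearMap.uncurryLeft (R := K) (M := fun _ : Fin (n + 1) => M)
      ((PiTensorProduct.lift (R := K) (s := fun _ : Fin n => M)
        (E := M ⊗[K] (⨂[K]^n M))).symm.toLinearMap ∘ₗ TensorProduct.mk K M (⨂[K]^n M)))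

variable (K Ω V : Type*) [Field K] [AddCommGroup V] [Module K V]

/-- The space `(KΩ)^{⊗ n} ⊗ V^{⊗ (n+1)}` spanned by the `Ω`-typed words in `V` of
length `n + 1`. -/
abbrev Piece (n : ℕ) : Type _ := (⨂[K]^n (Ω →₀ K)) ⊗[K] (⨂[K]^(n + 1) V)

/-- The space `Sh⁺_Ω(V) = ⨁_{n ≥ 1} (KΩ)^{⊗ (n-1)} ⊗ V^{⊗ n}` of `Ω`-typed words in `V`
(the summand of index `n` consists of the words of length `n + 1`). -/
abbrev Sh : Type _ := ⨁ n : ℕ, Piece K Ω V n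

/-- The inclusion in `Sh⁺_Ω(V)` of the words of length `n + 1`. -/
abbrev incl (n : ℕ) : Piece K Ω V n →ₗ[K] Sh K Ω V :=
  DirectSum.lof K ℕ (fun n => Piece K Ω V n) n

/-- The words of length one are the elements of `V`. -/
def pieceZeroEquiv : Piece K Ω V 0 ≃ₗ[K] V :=
  (TensorProduct.congr (PiTensorProduct.isEmptyEquiv (R := K) (s := fun _ : Fin 0 => Ω →₀ K)
      (ι := Fin 0))
    (PiTensorProduct.subsingletonEquiv (R := K) (s := fun _ : Fin 1 => V) (0 : Fin 1))).trans
    (TensorProduct.lid K V)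

/-- The inclusion of `V` in `Sh⁺_Ω(V)`. -/
def ofV : V →ₗ[K] Sh K Ω V := incl K Ω V 0 ∘ₗ (pieceZeroEquiv K Ω V).symm.toLinearMap

/-- Decomposition of words of length at least two:
`α₂⋯αₙ ⊗ v₁⋯vₙ ↦ (α₂ ⊗ v₁) ⊗ (α₃⋯αₙ ⊗ v₂⋯vₙ)`. -/
def pieceUncons (n : ℕ) :
    Piece K Ω V (n + 1) →ₗ[K] ((Ω →₀ K) ⊗[K] V) ⊗[K] Piece K Ω V n :=
  (TensorProduct.tensorTensorTensorComm K (Ω →₀ K) (⨂[K]^n (Ω →₀ K)) V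
    (⨂[K]^(n + 1) V)).toLinearMap ∘ₗ
    TensorProduct.map (tuncons K (Ω →₀ K) n) (tuncons K V (n + 1))

/-- Concatenation on each homogeneous component:
`(α ⊗ v) · (α₂⋯αₙ ⊗ v₁⋯vₙ) = αα₂⋯αₙ ⊗ vv₁⋯vₙ`. -/
def pieceCons (n : ℕ) :
    (Ω →₀ K) ⊗[K] V →ₗ[K] Piece K Ω V n →ₗ[K] Piece K Ω V (n + 1) :=
  TensorProduct.map₂ (tcons K (Ω →₀ K) n) (tcons K V (n + 1))

/-- The concatenation product `(KΩ ⊗ V) ⊗ Sh⁺_Ω(V) → Sh⁺_Ω(V)`. -/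
def concat : (Ω →₀ K) ⊗[K] V →ₗ[K] Sh K Ω V →ₗ[K] Sh K Ω V :=
  (DirectSum.toModule K ℕ ((Ω →₀ K) ⊗[K] V →ₗ[K] Sh K Ω V)
    fun n => ((pieceCons K Ω V n).compr₂ (incl K Ω V (n + 1))).flip).flip

variable {K Ω V}

/-- For `g : Ω → Ω` and bilinear maps `F γ`, the bilinear map
`((γ ⊗ v) ⊗ x, y) ↦ (g γ ⊗ v) · F γ (x, y)`. -/
def attach {M N : Type*} [AddCommMonoid M] [Module K M] [AddCommMonoid N] [Module K N]
    (g : Ω → Ω) (F : Ω → M →ₗ[K] N →ₗ[K] Sh K Ω V) :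
    ((Ω →₀ K) ⊗[K] V) ⊗[K] M →ₗ[K] N →ₗ[K] Sh K Ω V :=
  TensorProduct.lift (TensorProduct.lift (Finsupp.linearCombination K fun γ : Ω =>
    ({ toFun := fun v => (F γ).compr₂ (concat K Ω V (Finsupp.single (g γ) 1 ⊗ₜ[K] v))
       map_add' := by intro v w; ext; simp [TensorProduct.tmul_add]
       map_smul' := by intro c v; ext; simp } :
      V →ₗ[K] M →ₗ[K] N →ₗ[K] Sh K Ω V)))

mutual

/-- The product `≺_α` on homogeneous components, defined inductively by
`v ≺_α y = (α ⊗ v) · y` for `v` in `V`, and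
`((γ ⊗ v) · x) ≺_α y = ((γ ← α) ⊗ v) · (x ≺_{γ ◁ α} y) + ((γ → α) ⊗ v) · (x ≻_{γ ▷ α} y)`. -/
def precPiece (E : EDS Ω) : (m n : ℕ) → Ω → Piece K Ω V m →ₗ[K] Piece K Ω V n →ₗ[K] Sh K Ω V
  | 0, n, α =>
      ((concat K Ω V).compl₂ (incl K Ω V n)) ∘ₗ
        (TensorProduct.mk K (Ω →₀ K) V (Finsupp.single α 1)) ∘ₗ
        (pieceZeroEquiv K Ω V).toLinearMap
  | m + 1, n, α =>
      (attach (fun γ => E.left γ α) (fun γ => precPiece E m n (E.tleft γ α)) +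
        attach (fun γ => E.right γ α) (fun γ => succPiece E m n (E.tright γ α))) ∘ₗ
        pieceUncons K Ω V m
termination_by m n => m + n

/-- The product `≻_α` on homogeneous components, defined inductively by
`x ≻_α w = (α ⊗ w) · x` for `w` in `V`, and
`x ≻_α ((γ ⊗ w) · y) = ((α ← γ) ⊗ w) · (x ≺_{α ◁ γ} y) + ((α → γ) ⊗ w) · (x ≻_{α ▷ γ} y)`. -/
def succPiece (E : EDS Ω) : (m n : ℕ) → Ω → Piece K Ω V m →ₗ[K] Piece K Ω V n →ₗ[K] Sh K Ω V
  | m, 0, α =>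
      (((concat K Ω V).compl₂ (incl K Ω V m)) ∘ₗ
        (TensorProduct.mk K (Ω →₀ K) V (Finsupp.single α 1)) ∘ₗ
        (pieceZeroEquiv K Ω V).toLinearMap).flip
  | m, n + 1, α =>
      ((attach (fun γ => E.left α γ) (fun γ => (precPiece E m n (E.tleft α γ)).flip) +
        attach (fun γ => E.right α γ) (fun γ => (succPiece E m n (E.tright α γ)).flip)) ∘ₗ
        pieceUncons K Ω V n).flip
termination_by m n => m + n

end

/-- Bilinear extension to `Sh⁺_Ω(V)` of bilinear maps given on homogeneous components. -/
def extendPieces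
    (F : (m n : ℕ) → Piece K Ω V m →ₗ[K] Piece K Ω V n →ₗ[K] Sh K Ω V) :
    Sh K Ω V →ₗ[K] Sh K Ω V →ₗ[K] Sh K Ω V :=
  DirectSum.toModule K ℕ (Sh K Ω V →ₗ[K] Sh K Ω V) fun m =>
    (DirectSum.toModule K ℕ (Piece K Ω V m →ₗ[K] Sh K Ω V) fun n => (F m n).flip).flip

/-- The product `≺_α` of `Sh⁺_Ω(V)`. -/
def shPrec (E : EDS Ω) (α : Ω) : Sh K Ω V →ₗ[K] Sh K Ω V →ₗ[K] Sh K Ω V :=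
  extendPieces fun m n => precPiece E m n α

/-- The product `≻_α` of `Sh⁺_Ω(V)`. -/
def shSucc (E : EDS Ω) (α : Ω) : Sh K Ω V →ₗ[K] Sh K Ω V →ₗ[K] Sh K Ω V :=
  extendPieces fun m n => succPiece E m n α

end

end TypedWord

noncomputable section

/-- Bilinear extension to `KΩ ⊗ S` of the maps `(α ⊗ x, β ⊗ y) ↦ B α β (x, y)`. -/
def extendTyped {K Ω S T : Type*} [Field K] [AddCommMonoid S] [Module K S]
    [AddCommMonoid T] [Module K T] (B : Ω → Ω → S →ₗ[K] S →ₗ[K] T) :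
    (Ω →₀ K) ⊗[K] S →ₗ[K] (Ω →₀ K) ⊗[K] S →ₗ[K] T :=
  TensorProduct.lift (Finsupp.linearCombination K fun α =>
    (TensorProduct.lift (Finsupp.linearCombination K fun β => (B α β).flip)).flip)

/-- The product `α ⊗ x ≺ β ⊗ y = (α ← β) ⊗ (x ≺_{α ◁ β} y)` on `KΩ ⊗ S`, where `S` has
products `≺_α`. -/
def typedPrec {K Ω S : Type*} [Field K] [AddCommMonoid S] [Module K S] (E : EDS Ω)
    (prec : Ω → S →ₗ[K] S →ₗ[K] S) :
    (Ω →₀ K) ⊗[K] S →ₗ[K] (Ω →₀ K) ⊗[K] S →ₗ[K] (Ω →₀ K) ⊗[K] S :=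
  extendTyped fun α β =>
    (prec (E.tleft α β)).compr₂ (TensorProduct.mk K (Ω →₀ K) S (Finsupp.single (E.left α β) 1))

/-- The product `α ⊗ x ≻ β ⊗ y = (α → β) ⊗ (x ≻_{α ▷ β} y)` on `KΩ ⊗ S`, where `S` has
products `≻_α`. -/
def typedSucc {K Ω S : Type*} [Field K] [AddCommMonoid S] [Module K S] (E : EDS Ω)
    (succ : Ω → S →ₗ[K] S →ₗ[K] S) :
    (Ω →₀ K) ⊗[K] S →ₗ[K] (Ω →₀ K) ⊗[K] S →ₗ[K] (Ω →₀ K) ⊗[K] S :=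
  extendTyped fun α β =>
    (succ (E.tright α β)).compr₂ (TensorProduct.mk K (Ω →₀ K) S (Finsupp.single (E.right α β) 1))

/-- Dendriform algebras. -/
structure IsDendriform {K A : Type*} [Field K] [AddCommMonoid A] [Module K A]
    (prec succ : A →ₗ[K] A →ₗ[K] A) : Prop where
  prec_prec : ∀ x y z, prec (prec x y) z = prec x (prec y z + succ y z)
  succ_prec : ∀ x y z, prec (succ x y) z = succ x (prec y z)
  succ_succ : ∀ x y z, succ (prec x y + succ x y) z = succ x (succ y z)

/-- Dendriform bialgebras: dendriform algebras with a coassociative coproduct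
`Δ a = a' ⊗ a''` (no counit) such that, with `· = ≺ + ≻`,
`Δ(x ≺ y) = x ⊗ y + x' ≺ y ⊗ x'' + x' ⊗ x''·y + x ≺ y' ⊗ y'' + x' ≺ y' ⊗ x''·y''` and
`Δ(x ≻ y) = y ⊗ x + x' ≻ y ⊗ x'' + y' ⊗ x·y'' + x ≻ y' ⊗ y'' + x' ≻ y' ⊗ x''·y''`. -/
structure IsDendriformBialgebra {K A : Type*} [Field K] [AddCommMonoid A] [Module K A]
    (prec succ : A →ₗ[K] A →ₗ[K] A) (Δ : A →ₗ[K] A ⊗[K] A) : Prop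
    extends IsDendriform prec succ where
  coassoc : ∀ x, TensorProduct.assoc K A A A (TensorProduct.map Δ LinearMap.id (Δ x)) =
    TensorProduct.map LinearMap.id Δ (Δ x)
  comul_prec : ∀ x y, Δ (prec x y) =
    x ⊗ₜ[K] y
    + TensorProduct.map (prec.flip y) LinearMap.id (Δ x)
    + TensorProduct.map LinearMap.id ((prec + succ).flip y) (Δ x)
    + TensorProduct.map (prec x) LinearMap.id (Δ y)
    + TensorProduct.map₂ prec (prec + succ) (Δ x) (Δ y)
  comul_succ : ∀ x y, Δ (succ x y) =
    y ⊗ₜ[K] x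
    + TensorProduct.map (succ.flip y) LinearMap.id (Δ x)
    + TensorProduct.map LinearMap.id ((prec + succ) x) (Δ y)
    + TensorProduct.map (succ x) LinearMap.id (Δ y)
    + TensorProduct.map₂ succ (prec + succ) (Δ x) (Δ y)

end

-- Write a letter as `a = α ⊗ v`. Two facts drive both directions. For any EDS, `(a ≺ x) ≺ y = a ≺
-- (x ≺ y + x ≻ y)` (`letter_prec_prec`). And since `φ_←` is onto, each typed word of length at
-- least two splits as `a ≺ x` with `x` one letter shorter, so right combs in letters span.
--
-- Commutativity implies existence and uniqueness: here `≻` is the flip of `≺`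
-- (`typedSucc_eq_flip`), so `≺` is a half-shuffle product. The bialgebra axioms then follow from
-- the two facts alone, by induction on the number of letters. Compatibility with `Δ a = 0` forces
-- `Δ (a ≺ x) = a ⊗ x + a ≺ x' ⊗ x''`. This determines `Δ` on right combs, hence everywhere;
-- conversely, bijectivity of `φ_←` makes the splitting canonical, so this formula can be taken as a
-- recursive definition (`deconc`).
--
-- Existence implies commutativity: for letters, `Δ (a ≺ b) = a ⊗ b` and `Δ (b' ≻ a') = a' ⊗ b'`. If
-- the types of `b'`, `a'` are chosen with `φ_→ (b', a') = φ_← (a, b)`, both products are the same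
-- element, so `a = a'` and `b = b'`; this says that `φ_→` is `φ_←` with its arguments swapped.

section RightCombs

-- Half-shuffle products spanned by right combs, and their deconcatenation coproducts

variable {K A : Type*} [Field K] [AddCommMonoid A] [Module K A]

/-- Right combs `a₁ ≺ (a₂ ≺ (⋯ ≺ aₙ₊₁))` in elements of `g`. -/
inductive IsRightComb (prec : A →ₗ[K] A →ₗ[K] A) (g : Set A) : ℕ → A → Prop
  | gen {a : A} : a ∈ g → IsRightComb prec g 0 a
  | cons {a x : A} {n : ℕ} : a ∈ g → IsRightComb prec g n x → IsRightComb prec g (n + 1) (prec a x)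

/-- The bilinear map `prec` behaves like a half-shuffle product on right combs in `g`, which
span the space. -/
structure IsHalfShuffle (prec : A →ₗ[K] A →ₗ[K] A) (g : Set A) : Prop where
  span_eq_top : Submodule.span K {x | ∃ n, IsRightComb prec g n x} = ⊤
  gen_prec_prec : ∀ a ∈ g, ∀ x y, prec (prec a x) y = prec a (prec x y + prec y x)

/-- A coproduct vanishing on `g` and satisfying `Δ (a ≺ x) = a ⊗ x + a ≺ x' ⊗ x''`
for `a` in `g`. -/
structure IsDeconcatenation (prec : A →ₗ[K] A →ₗ[K] A) (g : Set A)
    (Δ : A →ₗ[K] A ⊗[K] A) : Prop where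
  gen : ∀ a ∈ g, Δ a = 0
  gen_prec : ∀ a ∈ g, ∀ x, Δ (prec a x) =
    a ⊗ₜ[K] x + TensorProduct.map (prec a) LinearMap.id (Δ x)

variable {prec : A →ₗ[K] A →ₗ[K] A} {g : Set A}

theorem IsHalfShuffle.induction (h : IsHalfShuffle prec g) {p : A → Prop}
    (comb : ∀ n x, IsRightComb prec g n x → p x) (zero : p 0)
    (add : ∀ x y, p x → p y → p (x + y)) (smul : ∀ (c : K) x, p x → p (c • x)) (x : A) : p x := by
  have hx : x ∈ Submodule.span K {x | ∃ n, IsRightComb prec g n x} := by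
    rw [h.span_eq_top]; trivial
  induction hx using Submodule.span_induction with
  | mem x hx => exact comb _ x hx.choose_spec
  | zero => exact zero
  | add x y _ _ hx hy => exact add x y hx hy
  | smul c x _ hx => exact smul c x hx

/-- Stripping the first letter `a` of the left factor turns both sides into `a ≺ _`. What remains is
associativity of the symmetrised product `x ≺ y + y ≺ x` on the tail, which follows from the
identity itself for four orderings of the shorter triple. Hence the induction is on the total
length, for all triples at once. -/
theorem IsHalfShuffle.prec_prec_of_isRightComb (h : IsHalfShuffle prec g) :
    ∀ N i j k x y z, i + j + k = N → IsRightComb prec g i x → IsRightComb prec g j y →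
      IsRightComb prec g k z → prec (prec x y) z = prec x (prec y z + prec z y) := by
  intro N
  induction N using Nat.strong_induction_on with
  | _ N ih =>
    intro i j k x y z hN hx hy hz
    cases hx with
    | gen ha => exact h.gen_prec_prec _ ha y z
    | @cons a x n ha hx =>
      have e1 := ih (n + j + k) (by omega) n j k x y z rfl hx hy hz
      have e2 := ih (n + j + k) (by omega) j n k y x z (by omega) hy hx hz
      have e3 := ih (n + j + k) (by omega) j k n y z x (by omega) hy hz hx
      have e4 := ih (n + j + k) (by omega) k j n z y x (by omega) hz hy hx
      simp only [h.gen_prec_prec a ha, map_add, LinearMap.add_apply] at e1 e2 e3 e4 ⊢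
      rw [e1, e2, e3, e4]
      simp only [map_add]
      abel

theorem IsHalfShuffle.prec_prec (h : IsHalfShuffle prec g) (x y z : A) :
    prec (prec x y) z = prec x (prec y z + prec z y) := by
  induction x using h.induction with
  | zero => simp
  | add x x' hx hx' => simp only [map_add, LinearMap.add_apply] at *; rw [hx, hx']; abel
  | smul c x hx => simp only [map_smul, LinearMap.smul_apply]; rw [hx]
  | comb i x hx =>
  induction y using h.induction with
  | zero => simp
  | add y y' hy hy' => simp only [map_add, LinearMap.add_apply] at *; rw [hy, hy']; abel
  | smul c y hy => simp only [map_smul, LinearMap.smul_apply, hy, ← smul_add]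
  | comb j y hy =>
  induction z using h.induction with
  | zero => simp
  | add z z' hz hz' => simp only [map_add, LinearMap.add_apply] at *; rw [hz, hz']; abel
  | smul c z hz => simp only [map_smul, LinearMap.smul_apply, hz, ← smul_add]
  | comb k z hz =>
  exact h.prec_prec_of_isRightComb _ i j k x y z rfl hx hy hz

theorem IsHalfShuffle.isDendriform (h : IsHalfShuffle prec g) : IsDendriform prec prec.flip where
  prec_prec x y z := h.prec_prec x y z
  succ_prec x y z := by
    simp only [LinearMap.flip_apply, h.prec_prec]
    rw [add_comm]
  succ_succ x y z := by
    simp only [LinearMap.flip_apply, h.prec_prec]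
    rw [add_comm]

variable {Δ : A →ₗ[K] A ⊗[K] A}

theorem IsDeconcatenation.coassoc (hΔ : IsDeconcatenation prec g Δ) (h : IsHalfShuffle prec g)
    (x : A) : TensorProduct.assoc K A A A (TensorProduct.map Δ LinearMap.id (Δ x)) =
      TensorProduct.map LinearMap.id Δ (Δ x) := by
  induction x using h.induction with
  | zero => simp
  | add x y hx hy => simp only [map_add, hx, hy]
  | smul c x hx => simp only [map_smul, hx]
  | comb n x hx =>
  induction hx with
  | gen ha => simp [hΔ.gen _ ha]
  | @cons a x n ha hx ih =>
    -- The extra term `a ⊗ Δ x` produced here on the left of coassociativity matches what `id ⊗ Δ`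
    -- makes of the summand `a ⊗ x`; on the left that summand dies because `Δ a = 0`.
    have left : ∀ t : A ⊗[K] A,
        TensorProduct.assoc K A A A (TensorProduct.map Δ LinearMap.id
          (TensorProduct.map (prec a) LinearMap.id t)) =
        a ⊗ₜ[K] t + TensorProduct.map (prec a) LinearMap.id
          (TensorProduct.assoc K A A A (TensorProduct.map Δ LinearMap.id t)) := by
      intro t
      induction t with
      | zero => simp
      | add s t hs ht => simp only [map_add, hs, ht, TensorProduct.tmul_add]; abel
      | tmul s t =>
        simp only [TensorProduct.map_tmul, LinearMap.id_apply, hΔ.gen_prec a ha,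
          TensorProduct.add_tmul, map_add, TensorProduct.assoc_tmul]
        congr 1
        induction Δ s with
        | zero => simp
        | add p q hp hq => simp only [map_add, TensorProduct.add_tmul, hp, hq]
        | tmul p q => simp
    have right : ∀ t : A ⊗[K] A,
        TensorProduct.map LinearMap.id Δ (TensorProduct.map (prec a) LinearMap.id t) =
        TensorProduct.map (prec a) LinearMap.id (TensorProduct.map LinearMap.id Δ t) := by
      intro t
      induction t with
      | zero => simp
      | add s t hs ht => simp only [map_add, hs, ht]
      | tmul s t => simp
    rw [hΔ.gen_prec a ha, map_add, map_add, map_add, left, right, ih]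
    simp [hΔ.gen a ha]

theorem map₂_flip_flip {M N P Q M' N' : Type*} [AddCommMonoid M] [AddCommMonoid N]
    [AddCommMonoid P] [AddCommMonoid Q] [AddCommMonoid M'] [AddCommMonoid N']
    [Module K M] [Module K N] [Module K P] [Module K Q] [Module K M'] [Module K N']
    (f : M →ₗ[K] N →ₗ[K] P) (f' : M' →ₗ[K] N' →ₗ[K] Q) (s : M ⊗[K] M') (t : N ⊗[K] N') :
    TensorProduct.map₂ f.flip f'.flip t s = TensorProduct.map₂ f f' s t := by
  induction s with
  | zero => simp
  | add s s' hs hs' => simp only [map_add, LinearMap.add_apply, hs, hs']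
  | tmul a b =>
    induction t with
    | zero => simp
    | add t t' ht ht' => simp only [map_add, LinearMap.add_apply, ht, ht']
    | tmul c d => simp

/-- The compatibility of `Δ` with a half-shuffle product, for a pair of elements. -/
def ComulPrec (prec : A →ₗ[K] A →ₗ[K] A) (Δ : A →ₗ[K] A ⊗[K] A) (x y : A) : Prop :=
  Δ (prec x y) =
    x ⊗ₜ[K] y
    + TensorProduct.map (prec.flip y) LinearMap.id (Δ x)
    + TensorProduct.map LinearMap.id ((prec + prec.flip).flip y) (Δ x)
    + TensorProduct.map (prec x) LinearMap.id (Δ y)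
    + TensorProduct.map₂ prec (prec + prec.flip) (Δ x) (Δ y)

/-- Since `(a ≺ x) ≺ y = a ≺ (x ≺ y + y ≺ x)`, the left side is governed by the formula for both
`(x, y)` and `(y, x)`, of smaller total length. -/
theorem IsDeconcatenation.comulPrec_of_isRightComb (hΔ : IsDeconcatenation prec g Δ)
    (h : IsHalfShuffle prec g) :
    ∀ N i j x y, i + j = N → IsRightComb prec g i x → IsRightComb prec g j y →
      ComulPrec prec Δ x y := by
  intro N
  induction N using Nat.strong_induction_on with
  | _ N ih =>
    intro i j x y hN hx hy
    cases hx with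
    | gen ha => simp [ComulPrec, hΔ.gen _ ha, hΔ.gen_prec _ ha]
    | @cons a x n ha hx =>
      have e1 := ih (n + j) (by omega) n j x y rfl hx hy
      have e2 := ih (n + j) (by omega) j n y x (by omega) hy hx
      rw [ComulPrec] at e1 e2 ⊢
      rw [h.gen_prec_prec a ha, hΔ.gen_prec a ha, map_add Δ, e1, e2, hΔ.gen_prec a ha x]
      -- The identities `c1` to `c5` pull the operator `(a ≺ _) ⊗ id` out of the terms on the right
      -- side, so that the two sides can be compared summand by summand.
      have c1 (s : A ⊗[K] A) : TensorProduct.map (prec.flip y) LinearMap.id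
          (TensorProduct.map (prec a) LinearMap.id s) =
          TensorProduct.map (prec a) LinearMap.id
            (TensorProduct.map (prec.flip y) LinearMap.id s +
              TensorProduct.map (prec y) LinearMap.id s) := by
        induction s with
        | zero => simp
        | add s s' hs hs' => simp only [map_add] at hs hs' ⊢; rw [hs, hs']; abel
        | tmul p q => simp [h.gen_prec_prec a ha, TensorProduct.add_tmul]
      have c2 (s : A ⊗[K] A) : TensorProduct.map LinearMap.id ((prec + prec.flip).flip y)
          (TensorProduct.map (prec a) LinearMap.id s) =
          TensorProduct.map (prec a) LinearMap.id
            (TensorProduct.map LinearMap.id ((prec + prec.flip).flip y) s) := by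
        induction s with
        | zero => simp
        | add s s' hs hs' => simp only [map_add] at hs hs' ⊢; rw [hs, hs']
        | tmul p q => simp
      have c3 (t : A ⊗[K] A) : TensorProduct.map (prec (prec a x)) LinearMap.id t =
          TensorProduct.map (prec a) LinearMap.id
            (TensorProduct.map (prec x) LinearMap.id t +
              TensorProduct.map (prec.flip x) LinearMap.id t) := by
        induction t with
        | zero => simp
        | add s s' hs hs' => simp only [map_add] at hs hs' ⊢; rw [hs, hs']; abel
        | tmul p q => simp [h.gen_prec_prec a ha, TensorProduct.add_tmul]
      have c4 (t : A ⊗[K] A) : TensorProduct.map₂ prec (prec + prec.flip) (a ⊗ₜ[K] x) t =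
          TensorProduct.map (prec a) LinearMap.id
            (TensorProduct.map LinearMap.id ((prec + prec.flip).flip x) t) := by
        induction t with
        | zero => simp
        | add s s' hs hs' => simp only [map_add] at hs hs' ⊢; rw [hs, hs']
        | tmul p q => simp [add_comm]
      have c5 (s t : A ⊗[K] A) : TensorProduct.map₂ prec (prec + prec.flip)
          (TensorProduct.map (prec a) LinearMap.id s) t =
          TensorProduct.map (prec a) LinearMap.id
            (TensorProduct.map₂ prec (prec + prec.flip) s t +
              TensorProduct.map₂ prec (prec + prec.flip) t s) := by
        -- This brings `s` to the same slot in every term, so that one induction handles them all.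
        rw [← map₂_flip_flip prec (prec + prec.flip) t s]
        induction s with
        | zero => simp
        | add s s' hs hs' =>
          simp only [map_add, LinearMap.add_apply] at hs hs' ⊢; rw [hs, hs']; abel
        | tmul p q =>
          induction t with
          | zero => simp
          | add s s' hs hs' => simp only [map_add] at hs hs' ⊢; rw [hs, hs']; abel
          | tmul p' q' =>
            simp [h.gen_prec_prec a ha, TensorProduct.add_tmul, TensorProduct.tmul_add]
            abel
      simp only [map_add (TensorProduct.map (prec.flip y) LinearMap.id),
        map_add (TensorProduct.map LinearMap.id ((prec + prec.flip).flip y)),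
        map_add (TensorProduct.map₂ prec (prec + prec.flip)), LinearMap.add_apply,
        c1, c2, c3, c4, c5]
      simp only [map_add, TensorProduct.map_tmul, LinearMap.id_apply, LinearMap.flip_apply,
        LinearMap.add_apply, TensorProduct.tmul_add]
      abel

theorem IsDeconcatenation.comulPrec (hΔ : IsDeconcatenation prec g Δ)
    (h : IsHalfShuffle prec g) (x y : A) : ComulPrec prec Δ x y := by
  induction x using h.induction with
  | zero => simp [ComulPrec]
  | add x x' hx hx' =>
    simp only [ComulPrec, map_add, LinearMap.add_apply, TensorProduct.add_tmul,
      TensorProduct.map_add_left] at *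
    rw [hx, hx']; abel
  | smul c x hx =>
    simp only [ComulPrec, map_smul, LinearMap.smul_apply, TensorProduct.map_smul_left,
      ← TensorProduct.smul_tmul', ← smul_add] at *
    rw [hx]
  | comb i x hx =>
  induction y using h.induction with
  | zero => simp [ComulPrec]
  | add y y' hy hy' =>
    simp only [ComulPrec, map_add, LinearMap.add_apply, TensorProduct.tmul_add,
      TensorProduct.map_add_left, TensorProduct.map_add_right] at *
    rw [hy, hy']; abel
  | smul c y hy =>
    simp only [ComulPrec, map_smul, LinearMap.smul_apply, TensorProduct.map_smul_left,
      TensorProduct.map_smul_right, TensorProduct.tmul_smul, ← smul_add] at *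
    rw [hy]
  | comb j y hy =>
  exact hΔ.comulPrec_of_isRightComb h _ i j x y rfl hx hy

theorem IsDeconcatenation.isDendriformBialgebra (hΔ : IsDeconcatenation prec g Δ)
    (h : IsHalfShuffle prec g) : IsDendriformBialgebra prec prec.flip Δ where
  toIsDendriform := h.isDendriform
  coassoc := hΔ.coassoc h
  comul_prec := hΔ.comulPrec h
  comul_succ x y := by
    have hflip : (prec + prec.flip).flip = prec + prec.flip := by
      ext a b; simp [add_comm]
    have e := map₂_flip_flip prec (prec + prec.flip) (Δ y) (Δ x)
    rw [hflip] at e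
    rw [e]
    have := hΔ.comulPrec h y x
    rw [ComulPrec, hflip] at this
    rw [LinearMap.flip_apply, this, LinearMap.flip_flip]
    abel

/-- In the compatibility for `≺`, only `a ⊗ x` and `a ≺ x' ⊗ x''` survive when `Δ a = 0`. This
reduces uniqueness to the recursion on right combs. -/
theorem IsDendriformBialgebra.isDeconcatenation {succ : A →ₗ[K] A →ₗ[K] A}
    (hΔ : IsDendriformBialgebra prec succ Δ) (hg : ∀ a ∈ g, Δ a = 0) :
    IsDeconcatenation prec g Δ where
  gen := hg
  gen_prec a ha x := by simp [hΔ.comul_prec, hg a ha]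

theorem IsDeconcatenation.unique {Δ' : A →ₗ[K] A ⊗[K] A} (hΔ : IsDeconcatenation prec g Δ)
    (hΔ' : IsDeconcatenation prec g Δ') (h : IsHalfShuffle prec g) : Δ = Δ' := by
  ext x
  induction x using h.induction with
  | zero => simp
  | add x y hx hy => simp only [map_add, hx, hy]
  | smul c x hx => simp only [map_smul, hx]
  | comb n x hx =>
  induction hx with
  | gen ha => rw [hΔ.gen _ ha, hΔ'.gen _ ha]
  | cons ha hx ih => rw [hΔ.gen_prec _ ha, hΔ'.gen_prec _ ha, ih]

end RightCombs

-- Typed products on elementary tensors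

theorem finsupp_tensor_induction {K Ω S : Type*} [Field K] [AddCommMonoid S] [Module K S]
    {p : (Ω →₀ K) ⊗[K] S → Prop} (single : ∀ α x, p (Finsupp.single α 1 ⊗ₜ[K] x)) (zero : p 0)
    (add : ∀ x y, p x → p y → p (x + y)) (t : (Ω →₀ K) ⊗[K] S) : p t := by
  induction t with
  | zero => exact zero
  | add x y hx hy => exact add x y hx hy
  | tmul f x =>
    induction f using Finsupp.induction_linear with
    | zero => simpa using zero
    | add f g hf hg => rw [TensorProduct.add_tmul]; exact add _ _ hf hg
    | single α c =>
      have h := single α (c • x)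
      rwa [← TensorProduct.smul_tmul, Finsupp.smul_single, smul_eq_mul, mul_one] at h

section Typed

variable {K Ω S : Type*} [Field K] [AddCommMonoid S] [Module K S]

theorem typedPrec_single_tmul (E : EDS Ω) (prec : Ω → S →ₗ[K] S →ₗ[K] S) (α β : Ω) (x y : S) :
    typedPrec E prec (Finsupp.single α 1 ⊗ₜ[K] x) (Finsupp.single β 1 ⊗ₜ[K] y) =
      Finsupp.single (E.left α β) 1 ⊗ₜ[K] prec (E.tleft α β) x y := by
  simp [typedPrec, extendTyped]

theorem typedSucc_single_tmul (E : EDS Ω) (succ : Ω → S →ₗ[K] S →ₗ[K] S) (α β : Ω) (x y : S) :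
    typedSucc E succ (Finsupp.single α 1 ⊗ₜ[K] x) (Finsupp.single β 1 ⊗ₜ[K] y) =
      Finsupp.single (E.right α β) 1 ⊗ₜ[K] succ (E.tright α β) x y := by
  simp [typedSucc, extendTyped]

end Typed

-- Adding and removing the first letter of a typed word

namespace TypedWord

section Tensors

variable {K M : Type*} [Field K] [AddCommGroup M] [Module K M]

theorem tcons_tprod (n : ℕ) (m : M) (f : Fin n → M) :
    tcons K M n m (PiTensorProduct.tprod K f) = PiTensorProduct.tprod K (Fin.cons m f) := by
  simp [tcons]

theorem tuncons_tprod (n : ℕ) (f : Fin (n + 1) → M) :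
    tuncons K M n (PiTensorProduct.tprod K f) =
      f 0 ⊗ₜ[K] PiTensorProduct.tprod K (Fin.tail f) := by
  simp [tuncons, PiTensorProduct.lift_symm]

theorem tuncons_tcons (n : ℕ) (m : M) (x : ⨂[K]^n M) :
    tuncons K M n (tcons K M n m x) = m ⊗ₜ[K] x := by
  have h : tuncons K M n ∘ₗ tcons K M n m = TensorProduct.mk K M (⨂[K]^n M) m := by
    apply PiTensorProduct.ext
    ext f
    simp [tcons_tprod, tuncons_tprod]
  exact LinearMap.congr_fun h x

theorem lift_tcons_tuncons (n : ℕ) (x : ⨂[K]^(n + 1) M) :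
    TensorProduct.lift (tcons K M n) (tuncons K M n x) = x := by
  have h : TensorProduct.lift (tcons K M n) ∘ₗ tuncons K M n = LinearMap.id := by
    apply PiTensorProduct.ext
    ext f
    simp [tcons_tprod, tuncons_tprod]
  exact LinearMap.congr_fun h x

end Tensors

variable {K Ω V : Type*} [Field K] [AddCommGroup V] [Module K V]

theorem pieceUncons_pieceCons (n : ℕ) (w : (Ω →₀ K) ⊗[K] V) (p : Piece K Ω V n) :
    pieceUncons K Ω V n (pieceCons K Ω V n w p) = w ⊗ₜ[K] p := by
  induction w with
  | zero => simp
  | add w w' hw hw' => simp only [map_add, LinearMap.add_apply, hw, hw', TensorProduct.add_tmul]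
  | tmul f v =>
    induction p using TensorProduct.induction_on with
    | zero => simp
    | add p q hp hq => simp only [map_add, hp, hq, TensorProduct.tmul_add]
    | tmul a b => simp [pieceUncons, pieceCons, tuncons_tcons]

theorem lift_pieceCons_pieceUncons (n : ℕ) (p : Piece K Ω V (n + 1)) :
    TensorProduct.lift (pieceCons K Ω V n) (pieceUncons K Ω V n p) = p := by
  induction p using TensorProduct.induction_on with
  | zero => simp
  | add p q hp hq => simp only [map_add, hp, hq]
  | tmul a b =>
    have h : ∀ s t, TensorProduct.lift (pieceCons K Ω V n)
        (TensorProduct.tensorTensorTensorComm K (Ω →₀ K) (⨂[K]^n (Ω →₀ K)) V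
          (⨂[K]^(n + 1) V) (s ⊗ₜ[K] t)) =
        TensorProduct.lift (tcons K (Ω →₀ K) n) s ⊗ₜ[K]
          TensorProduct.lift (tcons K V (n + 1)) t := by
      intro s t
      induction s with
      | zero => simp
      | add s s' hs hs' => simp only [TensorProduct.add_tmul, map_add, hs, hs']
      | tmul f a =>
        induction t with
        | zero => simp
        | add t t' ht ht' => simp only [TensorProduct.tmul_add, map_add, ht, ht']
        | tmul v b => simp [pieceCons]
    simp only [pieceUncons, LinearMap.comp_apply, TensorProduct.map_tmul,
      LinearEquiv.coe_coe, h, lift_tcons_tuncons]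

-- The inductive formulas for the products, on the whole space of typed words

theorem concat_incl (n : ℕ) (w : (Ω →₀ K) ⊗[K] V) (p : Piece K Ω V n) :
    concat K Ω V w (incl K Ω V n p) = incl K Ω V (n + 1) (pieceCons K Ω V n w p) := by
  simp [concat, incl]

theorem attach_tmul {M N : Type*} [AddCommMonoid M] [Module K M] [AddCommMonoid N] [Module K N]
    (g : Ω → Ω) (F : Ω → M →ₗ[K] N →ₗ[K] Sh K Ω V) (γ : Ω) (v : V) (x : M) (y : N) :
    attach g F ((Finsupp.single γ 1 ⊗ₜ[K] v) ⊗ₜ[K] x) y =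
      concat K Ω V (Finsupp.single (g γ) 1 ⊗ₜ[K] v) (F γ x y) := by
  simp [attach]

theorem extendPieces_incl
    (F : (m n : ℕ) → Piece K Ω V m →ₗ[K] Piece K Ω V n →ₗ[K] Sh K Ω V) (m n : ℕ)
    (p : Piece K Ω V m) (q : Piece K Ω V n) :
    extendPieces F (incl K Ω V m p) (incl K Ω V n q) = F m n p q := by
  simp [extendPieces, incl]

theorem sh_induction {P : Sh K Ω V → Prop} (incl : ∀ n p, P (incl K Ω V n p)) (zero : P 0)
    (add : ∀ x y, P x → P y → P (x + y)) (x : Sh K Ω V) : P x := by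
  classical
  induction x using DirectSum.induction_on with
  | zero => exact zero
  | of n p => exact incl n p
  | add x y hx hy => exact add x y hx hy

theorem shPrec_ofV (E : EDS Ω) (α : Ω) (v : V) (y : Sh K Ω V) :
    shPrec E α (ofV K Ω V v) y = concat K Ω V (Finsupp.single α 1 ⊗ₜ[K] v) y := by
  induction y using sh_induction with
  | zero => simp
  | add x y hx hy => simp only [map_add, hx, hy]
  | incl n q =>
    rw [ofV, LinearMap.comp_apply, shPrec, extendPieces_incl, precPiece]
    simp

theorem shSucc_ofV (E : EDS Ω) (α : Ω) (x : Sh K Ω V) (v : V) :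
    shSucc E α x (ofV K Ω V v) = concat K Ω V (Finsupp.single α 1 ⊗ₜ[K] v) x := by
  induction x using sh_induction with
  | zero => simp
  | add x y hx hy => simp only [map_add, LinearMap.add_apply, hx, hy]
  | incl n q =>
    rw [ofV, LinearMap.comp_apply, shSucc, extendPieces_incl, succPiece]
    simp

theorem shPrec_concat (E : EDS Ω) (α γ : Ω) (v : V) (x y : Sh K Ω V) :
    shPrec E α (concat K Ω V (Finsupp.single γ 1 ⊗ₜ[K] v) x) y =
      concat K Ω V (Finsupp.single (E.left γ α) 1 ⊗ₜ[K] v) (shPrec E (E.tleft γ α) x y) +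
      concat K Ω V (Finsupp.single (E.right γ α) 1 ⊗ₜ[K] v) (shSucc E (E.tright γ α) x y) := by
  induction x using sh_induction with
  | zero => simp
  | add x x' hx hx' => simp only [map_add, LinearMap.add_apply, hx, hx']; abel
  | incl m p =>
  induction y using sh_induction with
  | zero => simp
  | add y y' hy hy' => simp only [map_add, hy, hy']; abel
  | incl n q =>
    rw [concat_incl, shPrec, shPrec, shSucc, extendPieces_incl, extendPieces_incl,
      extendPieces_incl, precPiece, LinearMap.comp_apply, pieceUncons_pieceCons,
      LinearMap.add_apply, LinearMap.add_apply, attach_tmul, attach_tmul]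

-- Commutative EDS: the two products are opposite

/-- The recursions of `≻` on its right factor and of `≺` on its left factor have the same two terms
in exchanged order once `→`, `▷` are the opposites of `←`, `◁`. -/
theorem succPiece_eq_flip_precPiece {E : EDS Ω} (hE : E.Commutative) :
    ∀ N m n, m + n = N → ∀ α,
      (succPiece E m n α : Piece K Ω V m →ₗ[K] Piece K Ω V n →ₗ[K] Sh K Ω V) =
        (precPiece E n m α).flip := by
  intro N
  induction N with
  | zero =>
    intro m n h α
    obtain rfl : n = 0 := by omega
    rw [succPiece, precPiece]
  | succ N ih =>
    intro m n h α
    cases n with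
    | zero => rw [succPiece, precPiece]
    | succ n =>
      have e1 : ∀ γ, E.right α γ = E.left γ α := fun γ => (hE α γ).1
      have e2 : ∀ γ, E.tright α γ = E.tleft γ α := fun γ => (hE α γ).2
      have e3 : ∀ γ, E.right γ α = E.left α γ := fun γ => (hE γ α).1
      have e4 : ∀ γ, E.tright γ α = E.tleft α γ := fun γ => (hE γ α).2
      rw [succPiece, precPiece]
      simp only [e1, e2, e3, e4, ih m n (by omega), ih n m (by omega), LinearMap.flip_flip]
      congr 2
      exact add_comm _ _

theorem shSucc_eq_shPrec {E : EDS Ω} (hE : E.Commutative) (α : Ω) (x y : Sh K Ω V) :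
    shSucc E α x y = shPrec E α y x := by
  induction x using sh_induction with
  | zero => simp
  | add x x' hx hx' => simp only [map_add, LinearMap.add_apply, hx, hx']
  | incl m p =>
  induction y using sh_induction with
  | zero => simp
  | add y y' hy hy' => simp only [map_add, LinearMap.add_apply, hy, hy']
  | incl n q =>
    rw [shSucc, shPrec, extendPieces_incl, extendPieces_incl,
      succPiece_eq_flip_precPiece hE _ m n rfl, LinearMap.flip_apply]

theorem typedSucc_eq_flip {E : EDS Ω} (hE : E.Commutative) :
    typedSucc E (shSucc (K := K) (V := V) E) = (typedPrec E (shPrec E)).flip := by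
  refine LinearMap.ext₂ fun x y => ?_
  rw [LinearMap.flip_apply]
  induction x using finsupp_tensor_induction with
  | zero => simp
  | add x x' hx hx' => simp only [map_add, LinearMap.add_apply, hx, hx']
  | single α x =>
  induction y using finsupp_tensor_induction with
  | zero => simp
  | add y y' hy hy' => simp only [map_add, LinearMap.add_apply, hy, hy']
  | single β y =>
    rw [typedSucc_single_tmul, typedPrec_single_tmul, (hE α β).1, (hE α β).2,
      shSucc_eq_shPrec hE]

-- Letters generate a half-shuffle structure

variable (K Ω V) in
/-- The letters `α ⊗ v` of `KΩ ⊗ Sh⁺_Ω(V)`. -/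
def letters : Set ((Ω →₀ K) ⊗[K] Sh K Ω V) :=
  {a | ∃ α v, a = Finsupp.single α 1 ⊗ₜ[K] ofV K Ω V v}

theorem typedPrec_letter (E : EDS Ω) (α β : Ω) (v : V) (x : Sh K Ω V) :
    typedPrec E (shPrec E) (Finsupp.single α 1 ⊗ₜ[K] ofV K Ω V v) (Finsupp.single β 1 ⊗ₜ[K] x) =
      Finsupp.single (E.left α β) 1 ⊗ₜ[K]
        concat K Ω V (Finsupp.single (E.tleft α β) 1 ⊗ₜ[K] v) x := by
  rw [typedPrec_single_tmul, shPrec_ofV]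

/-- This is where the EDS axioms enter: the four identities with `δ = α ◁ β`, `ε = (α ← β) ◁ γ`
match the inner types, and the associativity axioms of `←` match the outer one. -/
theorem letter_prec_prec (E : EDS Ω) (α : Ω) (v : V) (x y : (Ω →₀ K) ⊗[K] Sh K Ω V) :
    typedPrec E (shPrec E)
        (typedPrec E (shPrec E) (Finsupp.single α 1 ⊗ₜ[K] ofV K Ω V v) x) y =
      typedPrec E (shPrec E) (Finsupp.single α 1 ⊗ₜ[K] ofV K Ω V v)
        (typedPrec E (shPrec E) x y + typedSucc E (shSucc E) x y) := by
  induction x using finsupp_tensor_induction with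
  | zero => simp
  | add x x' hx hx' => simp only [map_add, LinearMap.add_apply] at hx hx' ⊢; rw [hx, hx']; abel
  | single β x =>
  induction y using finsupp_tensor_induction with
  | zero => simp
  | add y y' hy hy' => simp only [map_add] at hy hy' ⊢; rw [hy, hy']; abel
  | single γ y =>
    rw [typedPrec_letter, typedPrec_single_tmul, typedPrec_single_tmul, typedSucc_single_tmul,
      map_add, typedPrec_letter, typedPrec_letter, shPrec_concat, E.tleft_left, E.tleft_tleft,
      E.tleft_right, E.tleft_tright, TensorProduct.tmul_add, E.left_left, ← E.left_left']

theorem single_tmul_incl_mem_span {E : EDS Ω} (hE : Function.Surjective E.phiLeft) (n : ℕ) :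
    ∀ (α : Ω) (p : Piece K Ω V n), Finsupp.single α 1 ⊗ₜ[K] incl K Ω V n p ∈
      Submodule.span K
        {x | ∃ n, IsRightComb (typedPrec E (shPrec E)) (letters K Ω V) n x} := by
  induction n with
  | zero =>
    intro α p
    refine Submodule.subset_span ⟨0, .gen ⟨α, pieceZeroEquiv K Ω V p, ?_⟩⟩
    simp [ofV]
  | succ n ih =>
    intro α p
    rw [← lift_pieceCons_pieceUncons n p]
    induction pieceUncons K Ω V n p with
    | zero => simp
    | add s t hs ht =>
      rw [map_add, map_add, TensorProduct.tmul_add]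
      exact add_mem hs ht
    | tmul w q =>
      induction w using finsupp_tensor_induction with
      | zero => simp
      | add s t hs ht =>
        rw [TensorProduct.add_tmul, map_add, map_add, TensorProduct.tmul_add]
        exact add_mem hs ht
      | single γ v =>
        -- The outer type `α` and the first inner type `γ` are the two components of `φ_← (α', β)`;
        -- so the word is the letter `α' ⊗ v` times, under `≺`, the tail carrying the type `β`.
        obtain ⟨⟨α', β⟩, h⟩ := hE (α, γ)
        obtain ⟨rfl, rfl⟩ := Prod.mk.inj h
        rw [TensorProduct.lift.tmul, ← concat_incl, ← typedPrec_letter]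
        have hq := ih β q
        generalize (Finsupp.single β 1 ⊗ₜ[K] incl K Ω V n q :
          (Ω →₀ K) ⊗[K] Sh K Ω V) = z at hq
        induction hq using Submodule.span_induction with
        | mem x hx =>
          obtain ⟨k, hx⟩ := hx
          exact Submodule.subset_span ⟨k + 1, .cons ⟨_, _, rfl⟩ hx⟩
        | zero => simp
        | add x y _ _ hx hy => rw [map_add]; exact add_mem hx hy
        | smul c x _ hx => rw [map_smul]; exact Submodule.smul_mem _ _ hx

theorem isHalfShuffle {E : EDS Ω} (hE : Function.Surjective E.phiLeft) (hc : E.Commutative) :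
    IsHalfShuffle (typedPrec E (shPrec E)) (letters K Ω V) where
  span_eq_top := by
    rw [eq_top_iff]
    intro x hx
    clear hx
    induction x using finsupp_tensor_induction with
    | zero => exact zero_mem _
    | add x y hx hy => exact add_mem hx hy
    | single α x =>
      induction x using sh_induction with
      | zero => simp
      | add x y hx hy => rw [TensorProduct.tmul_add]; exact add_mem hx hy
      | incl n p => exact single_tmul_incl_mem_span hE n α p
  gen_prec_prec := by
    rintro a ⟨α, v, rfl⟩ x y
    rw [letter_prec_prec, typedSucc_eq_flip hc, LinearMap.flip_apply]

-- Existence of the deconcatenation coproduct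

/-- The deconcatenation coproduct on `α ⊗ p`, for `p` a typed word of length `n + 1`. -/
noncomputable def deconcPiece {E : EDS Ω} (hE : Function.Bijective E.phiLeft) : (n : ℕ) → Ω →
    Piece K Ω V n →ₗ[K] ((Ω →₀ K) ⊗[K] Sh K Ω V) ⊗[K] ((Ω →₀ K) ⊗[K] Sh K Ω V)
  | 0, _ => 0
  | n + 1, α =>
    TensorProduct.lift (TensorProduct.lift (Finsupp.linearCombination K fun γ : Ω =>
      LinearMap.mk₂ K (fun v p =>
        ((Finsupp.single ((Equiv.ofBijective _ hE).symm (α, γ)).1 1 : Ω →₀ K) ⊗ₜ[K]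
            ofV K Ω V v) ⊗ₜ[K]
          ((Finsupp.single ((Equiv.ofBijective _ hE).symm (α, γ)).2 1 : Ω →₀ K) ⊗ₜ[K]
            incl K Ω V n p) +
        TensorProduct.map (typedPrec E (shPrec E)
          (Finsupp.single ((Equiv.ofBijective _ hE).symm (α, γ)).1 1 ⊗ₜ[K] ofV K Ω V v))
          LinearMap.id (deconcPiece hE n ((Equiv.ofBijective _ hE).symm (α, γ)).2 p))
        (by
          intro v v' p
          simp only [map_add, TensorProduct.tmul_add, TensorProduct.add_tmul,
            TensorProduct.map_add_left, LinearMap.add_apply]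
          abel)
        (by
          intro c v p
          simp only [map_smul, TensorProduct.tmul_smul, ← TensorProduct.smul_tmul',
            TensorProduct.map_smul_left, LinearMap.smul_apply, smul_add])
        (by
          intro v p p'
          simp only [map_add, TensorProduct.tmul_add]
          abel)
        (by
          intro c v p
          simp only [map_smul, TensorProduct.tmul_smul, smul_add]))) ∘ₗ
      pieceUncons K Ω V n

/-- The deconcatenation coproduct of `KΩ ⊗ Sh⁺_Ω(V)`. -/
noncomputable def deconc {E : EDS Ω} (hE : Function.Bijective E.phiLeft) :
    (Ω →₀ K) ⊗[K] Sh K Ω V →ₗ[K]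
      ((Ω →₀ K) ⊗[K] Sh K Ω V) ⊗[K] ((Ω →₀ K) ⊗[K] Sh K Ω V) :=
  TensorProduct.lift (Finsupp.linearCombination K fun α =>
    DirectSum.toModule K ℕ _ fun n => deconcPiece hE n α)

theorem deconc_single_tmul_incl {E : EDS Ω} (hE : Function.Bijective E.phiLeft) (α : Ω) (n : ℕ)
    (p : Piece K Ω V n) :
    deconc hE (Finsupp.single α 1 ⊗ₜ[K] incl K Ω V n p) = deconcPiece hE n α p := by
  simp [deconc, incl]

theorem isDeconcatenation_deconc {E : EDS Ω} (hE : Function.Bijective E.phiLeft) :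
    IsDeconcatenation (typedPrec E (shPrec E)) (letters K Ω V) (deconc hE) where
  gen := by
    rintro a ⟨α, v, rfl⟩
    rw [ofV, LinearMap.comp_apply, deconc_single_tmul_incl, deconcPiece, LinearMap.zero_apply]
  gen_prec := by
    rintro a ⟨α, v, rfl⟩ x
    induction x using finsupp_tensor_induction with
    | zero => simp
    | add x y hx hy => simp only [map_add, TensorProduct.tmul_add, hx, hy]; abel
    | single β x =>
      induction x using sh_induction with
      | zero => simp
      | add x y hx hy => simp only [map_add, TensorProduct.tmul_add, hx, hy]; abel
      | incl n p =>
        -- Injectivity of `φ_←` recovers from the product `a ≺ x` the types of its two factors.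
        have h : (Equiv.ofBijective _ hE).symm (E.left α β, E.tleft α β) = (α, β) :=
          (Equiv.ofBijective _ hE).symm_apply_apply (α, β)
        rw [typedPrec_letter, concat_incl, deconc_single_tmul_incl, deconc_single_tmul_incl,
          deconcPiece, LinearMap.comp_apply, pieceUncons_pieceCons]
        simp [h]

-- A compatible coproduct forces commutativity

/-- A functional nonzero at `v`, extended by zero to longer words, sends both sides to multiples of
basis vectors indexed by `Ω × Ω`, with the same nonzero coefficient `f v * f v`. -/
theorem letter_tmul_letter_injective {v : V} (hv : v ≠ 0) {α β α' β' : Ω}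
    (h : ((Finsupp.single α 1 : Ω →₀ K) ⊗ₜ[K] ofV K Ω V v) ⊗ₜ[K]
        ((Finsupp.single β 1 : Ω →₀ K) ⊗ₜ[K] ofV K Ω V v) =
      ((Finsupp.single α' 1 : Ω →₀ K) ⊗ₜ[K] ofV K Ω V v) ⊗ₜ[K]
        ((Finsupp.single β' 1 : Ω →₀ K) ⊗ₜ[K] ofV K Ω V v)) : α = α' ∧ β = β' := by
  obtain ⟨f, hf⟩ : ∃ f : Module.Dual K V, f v ≠ 0 := by
    by_contra! H
    exact hv ((Module.forall_dual_apply_eq_zero_iff K v).1 H)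
  let π : Sh K Ω V →ₗ[K] K := f ∘ₗ (pieceZeroEquiv K Ω V).toLinearMap ∘ₗ
    DirectSum.component K ℕ (fun n => Piece K Ω V n) 0
  have hπ : π (ofV K Ω V v) = f v := by
    simp [π, ofV, incl, DirectSum.component.lof_self]
  let q : (Ω →₀ K) ⊗[K] Sh K Ω V →ₗ[K] (Ω →₀ K) :=
    (TensorProduct.rid K (Ω →₀ K)).toLinearMap ∘ₗ TensorProduct.map LinearMap.id π
  have hq : ∀ γ : Ω, q (Finsupp.single γ 1 ⊗ₜ[K] ofV K Ω V v) = Finsupp.single γ (f v) := by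
    intro γ
    simp [q, hπ]
  have h' := congrArg (fun t => finsuppTensorFinsupp' K Ω Ω (TensorProduct.map q q t)) h
  simp only [TensorProduct.map_tmul, hq, finsuppTensorFinsupp'_single_tmul_single] at h'
  exact Prod.mk.inj (Finsupp.single_left_injective (mul_ne_zero hf hf) h')

theorem commutative_of_isDendriformBialgebra [Nontrivial V] {E : EDS Ω}
    (hE : Function.Surjective E.phiRight)
    {Δ : (Ω →₀ K) ⊗[K] Sh K Ω V →ₗ[K]
      ((Ω →₀ K) ⊗[K] Sh K Ω V) ⊗[K] ((Ω →₀ K) ⊗[K] Sh K Ω V)}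
    (hΔ : IsDendriformBialgebra (typedPrec E (shPrec E)) (typedSucc E (shSucc E)) Δ)
    (h0 : ∀ (α : Ω) (v : V), Δ (Finsupp.single α 1 ⊗ₜ[K] ofV K Ω V v) = 0) :
    E.Commutative := by
  obtain ⟨v, hv⟩ := exists_ne (0 : V)
  intro b a
  -- With this choice, and the same vector `v` in all letters, `a ≺ b` and `b' ≻ a'` are one
  -- element, whose coproduct is computed in two ways.
  obtain ⟨⟨b', a'⟩, h⟩ := hE (E.phiLeft (a, b))
  obtain ⟨h1, h2⟩ := Prod.mk.inj h
  have e1 := hΔ.comul_prec (Finsupp.single a 1 ⊗ₜ[K] ofV K Ω V v)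
    (Finsupp.single b 1 ⊗ₜ[K] ofV K Ω V v)
  have e2 := hΔ.comul_succ (Finsupp.single b' 1 ⊗ₜ[K] ofV K Ω V v)
    (Finsupp.single a' 1 ⊗ₜ[K] ofV K Ω V v)
  rw [typedPrec_letter] at e1
  rw [typedSucc_single_tmul, shSucc_ofV] at e2
  simp only at h1 h2
  rw [h1, h2, e1] at e2
  simp only [h0, map_zero, add_zero] at e2
  obtain ⟨rfl, rfl⟩ := letter_tmul_letter_injective hv e2
  exact ⟨h1, h2⟩

end TypedWord

theorem proposition40 {K Ω V : Type*} [Field K] [AddCommGroup V] [Module K V] [Nontrivial V]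
    (E : EDS Ω) (hE : E.Nondegenerate) :
    (∃! Δ : ((Ω →₀ K) ⊗[K] TypedWord.Sh K Ω V) →ₗ[K]
        ((Ω →₀ K) ⊗[K] TypedWord.Sh K Ω V) ⊗[K] ((Ω →₀ K) ⊗[K] TypedWord.Sh K Ω V),
      IsDendriformBialgebra (typedPrec E (TypedWord.shPrec (K := K) (V := V) E))
        (typedSucc E (TypedWord.shSucc (K := K) (V := V) E)) Δ ∧
      ∀ (α : Ω) (v : V), Δ (Finsupp.single α 1 ⊗ₜ[K] TypedWord.ofV K Ω V v) = 0) ↔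
    E.Commutative := by
  constructor
  · rintro ⟨Δ, ⟨hΔ, h0⟩, -⟩
    exact TypedWord.commutative_of_isDendriformBialgebra hE.2.2 hΔ h0
  · intro hc
    have hs := TypedWord.isHalfShuffle (K := K) (V := V) hE.1.2 hc
    have hd := TypedWord.isDeconcatenation_deconc (K := K) (V := V) hE.1
    refine ⟨TypedWord.deconc hE.1, ⟨?_, fun α v => hd.gen _ ⟨α, v, rfl⟩⟩, ?_⟩
    · rw [TypedWord.typedSucc_eq_flip hc]
      exact hd.isDendriformBialgebra hs
    · rintro Δ ⟨hΔ, h0⟩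
      refine (hΔ.isDeconcatenation ?_).unique hd hs
      rintro a ⟨α, v, rfl⟩
      exact h0 α v
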